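/- **Lemma 2.3.** Let $h>R>0$, and let $$\Omega=\{(x,y,z)\in\mathbb{R}^3 \mid x^2+y^2<R^2,\ -h<z<h\},$$ with middle cross-section $\Sigma=D((0,0),R)\subset\mathbb{R}^2$, where $D(\xi,r)\subset\mathbb{R}^2$ is the open disk with center $\xi$ and radius $r$. Let $(K_n)_{n}$ be a sequence of open, bounded, simply connected subsets of $\mathbb{R}^2$ with $\mathcal{C}^2$-boundary, such that $(0,0)\in K_n$ for all $n$ and $\sup_n|K_n|<\infty$. Let $\varepsilon_*\in(0,1)$ be such that $\varepsilon_*|K_n|<\pi R^2$ for all $n$, let $\alpha>0$, and put $r_\varepsilon=\exp(-\varepsilon^{-\alpha})$ for $\varepsilon\in I_*:=(0,\varepsilon_*]$. Let $\delta_0,\delta_1>0$ be independent of $\varepsilon$, and suppose that for every $\varepsilon\in I_*$ there are an integer $N(\varepsilon)\ge 1$ and points $\xi^\varepsilon_1,\dots,\xi^\varepsilon_{N(\varepsilon)}\in\mathbb{R}^2$ such that, for all $n,m\in\{1,\dots,N(\varepsilon)\}$ with $n\neq m$, $$\xi^\varepsilon_n+r_\varepsilon\overline{K_n}\subset D(\xi^\varepsilon_n,\delta_0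 r_\varepsilon)\subset D(\xi^\varepsilon_n,\delta_1\varepsilon)\subset\Sigma,$$ $$\partial D(\xi^\varepsilon_n,\delta_1\varepsilon)\cap\partial D(\xi^\varepsilon_m,\delta_1\varepsilon)=\emptyset,\qquad \partial D(\xi^\varepsilon_n,\delta_1\varepsilon)\cap\partial\Sigma=\emptyset .$$ Put $K^\varepsilon_n=\xi^\varepsilon_n+r_\varepsilon K_n$, let $\Gamma_\varepsilon=\Sigma\setminus\bigcup_{n=1}^{N(\varepsilon)}\overline{K^\varepsilon_n}$ be the sieve, viewed as a subset of the plane $\{z=0\}$, and let $\Omega_\varepsilon=\Omega\setminus\overline{\Gamma_\varepsilon}$ be the perforated domain. For a bounded open set $Q\subset\mathbb{R}^3$, let $L^2_0(Q)$ be the space of functions in $L^2(Q)$ with zero mean, let $H^1_0(Q)$ be the closure of the smooth compactly supported vector fields $Q\to\mathbb{R}^3$ in $H^1(Q)$, and let $$C_B(Q)=\sup_{g\in L^2_0(Q)\setminus\{0\}}\ \inf\left\{\frac{\|\nabla v\|_{L^2(Q)}}{\|g\|_{L^2(Q)}}\ \Big|\ v\in H^1_0(Q),\ \nabla\cdot v=g\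 \text{in } Q\right\}\in[0,\infty]$$ be the Bogovskii constant of $Q$. Then there is a constant $C_*>0$, depending only on $\Omega$ (that is, on $R$ and $h$), $\delta_0$ and $\delta_1$, such that $$C_B(\Omega_\varepsilon)\ \ge\ \frac{C_*}{\sqrt{r_\varepsilon}}\qquad\text{for all }\varepsilon\in I_* .$$ -/

import Mathlib

open scoped ENNReal ContDiff
open MeasureTheory

noncomputable section

/-! Sobolev spaces and the Bogovskii constant of a set `Q ⊆ ℝ³`. -/

/-- The Euclidean plane. -/
abbrev E2 : Type := EuclideanSpace ℝ (Fin 2)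

/-- The Euclidean space of dimension three; coordinates `x 0, x 1, x 2` stand for `x, y, z`. -/
abbrev E3 : Type := EuclideanSpace ℝ (Fin 3)

/-- Real `3 × 3` matrices with the Euclidean (Frobenius) norm. -/
abbrev Mat3 : Type := EuclideanSpace ℝ (Fin 3 × Fin 3)

/-- The classical partial derivative `∂ⱼ φ (x)` of a scalar function. -/
def partialDeriv (j : Fin 3) (φ : E3 → ℝ) (x : E3) : ℝ :=
  fderiv ℝ φ x (EuclideanSpace.single j 1)

/-- The classical gradient of a vector field: the entry `(i, j)` is `∂ⱼ vᵢ`. -/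
def gradField (v : E3 → E3) (x : E3) : Mat3 :=
  WithLp.toLp 2 fun ij : Fin 3 × Fin 3 => partialDeriv ij.2 (fun y => v y ij.1) x

/-- `φ ∈ C_c^∞(Q)`, for scalar or vector valued `φ`. -/
structure IsTestFunction {F : Type*} [NormedAddCommGroup F] [NormedSpace ℝ F]
    (Q : Set E3) (φ : E3 → F) : Prop where
  smooth : ContDiff ℝ ∞ φ
  compact : HasCompactSupport φ
  support_subset : tsupport φ ⊆ Q

/-- `G` is a weak gradient of `v` in `Q`: the entry `G (i, j)` is the weak derivative `∂ⱼ vᵢ`. -/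
def HasWeakGradient (Q : Set E3) (v : E3 → E3) (G : E3 → Mat3) : Prop :=
  ∀ (i j : Fin 3) (φ : E3 → ℝ), IsTestFunction Q φ →
    ∫ x in Q, v x i * partialDeriv j φ x = - ∫ x in Q, G x (i, j) * φ x

/-- The vector field `v` lies in `H¹(Q)` and `∇v = G` in `Q`. -/
structure MemH1 (Q : Set E3) (v : E3 → E3) (G : E3 → Mat3) : Prop where
  memLp : MemLp v 2 (volume.restrict Q)
  memLp_grad : MemLp G 2 (volume.restrict Q)
  weakGradient : HasWeakGradient Q v G

/-- The vector field `v` lies in `H¹₀(Q)`, the closure of `C_c^∞(Q)` in `H¹(Q)`, and `∇v = G`. -/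
structure MemH10 (Q : Set E3) (v : E3 → E3) (G : E3 → Mat3) : Prop where
  memH1 : MemH1 Q v G
  approx : ∃ φ : ℕ → E3 → E3, (∀ k, IsTestFunction Q (φ k)) ∧
    Filter.Tendsto (fun k => eLpNorm (fun x => φ k x - v x) 2 (volume.restrict Q))
      Filter.atTop (nhds 0) ∧
    Filter.Tendsto (fun k => eLpNorm (fun x => gradField (φ k) x - G x) 2 (volume.restrict Q))
      Filter.atTop (nhds 0)

/-- `g ∈ L²₀(Q) \ {0}`: square integrable with zero mean, not a.e. zero. -/
structure MemL20NeZero (Q : Set E3) (g : E3 → ℝ) : Prop where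
  memLp : MemLp g 2 (volume.restrict Q)
  mean_zero : ∫ x in Q, g x = 0
  ne_zero : ¬ (g =ᵐ[volume.restrict Q] 0)

/-- The Bogovskii constant of `Q`, as an extended nonnegative real number: the supremum over
`g ∈ L²₀(Q) \ {0}` of the infimum of `‖∇v‖_{L²(Q)} / ‖g‖_{L²(Q)}` over all `v ∈ H¹₀(Q)` with
`∇ · v = g` in `Q`. -/
def bogovskiiConstant (Q : Set E3) : ℝ≥0∞ :=
  ⨆ (g : E3 → ℝ) (_ : MemL20NeZero Q g),
    ⨅ (v : E3 → E3) (G : E3 → Mat3) (_ : MemH10 Q v G)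
      (_ : ∀ᵐ x ∂(volume.restrict Q), ∑ i : Fin 3, G x (i, i) = g x),
      eLpNorm G 2 (volume.restrict Q) / eLpNorm g 2 (volume.restrict Q)

/-! The perforated cylinder. -/

/-- The open cylinder `Ω` of radius `R` and length `2h`. -/
def cylinder (R h : ℝ) : Set E3 :=
  {x | x 0 ^ 2 + x 1 ^ 2 < R ^ 2 ∧ -h < x 2 ∧ x 2 < h}

/-- The planar set `S`, viewed in the plane `z = 0` of the space. -/
def inPlane (S : Set E2) : Set E3 :=
  {x | !₂[x 0, x 1] ∈ S ∧ x 2 = 0}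

/-- `K` has a boundary of class `C²`: near each boundary point, `K` is the sublevel set of a `C²`
function whose differential does not vanish at that point. -/
def HasC2Boundary (K : Set E2) : Prop :=
  ∀ p ∈ frontier K, ∃ (U : Set E2) (ρ : E2 → ℝ), IsOpen U ∧ p ∈ U ∧ ContDiffOn ℝ 2 ρ U ∧
    fderiv ℝ ρ p ≠ 0 ∧ K ∩ U = {q | q ∈ U ∧ ρ q < 0}

/-- The scale `r_ε = exp (-ε^{-α})` of the apertures. -/
def apertureScale (α ε : ℝ) : ℝ := Real.exp (-(ε ^ (-α)))

/-- The set `ξ + r S`. -/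
def placed (ξ : E2) (r : ℝ) (S : Set E2) : Set E2 := (fun p => ξ + r • p) '' S

/-- The data of a family of sieves in the disk `Σ = D(0, R)`, with constants `δ₀, δ₁`: reference
shapes `K n`, an exponent `α`, a threshold `εStar`, and for each `ε ∈ (0, εStar]` the number `N ε`
of apertures and their centers `ξ ε n`, `n < N ε` (counted from zero; the values of `N ε` and
`ξ ε n` for other `ε`, `n` are never used). -/
structure SieveFamily (R δ₀ δ₁ : ℝ) where
  K : ℕ → Set E2
  isOpen_K : ∀ n, IsOpen (K n)
  isBounded_K : ∀ n, Bornology.IsBounded (K n)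
  simplyConnected_K : ∀ n, IsSimplyConnected (K n)
  c2Boundary_K : ∀ n, HasC2Boundary (K n)
  zero_mem_K : ∀ n, (0 : E2) ∈ K n
  sup_area_K : (⨆ n, volume (K n)) < ⊤
  εStar : ℝ
  εStar_pos : 0 < εStar
  εStar_lt_one : εStar < 1
  εStar_area : ∀ n, ENNReal.ofReal εStar * volume (K n) < ENNReal.ofReal (Real.pi * R ^ 2)
  α : ℝ
  α_pos : 0 < α
  N : ℝ → ℕ
  ξ : ℝ → ℕ → E2
  one_le_N : ∀ ε ∈ Set.Ioc 0 εStar, 1 ≤ N ε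
  aperture_subset : ∀ ε ∈ Set.Ioc 0 εStar, ∀ n < N ε,
    placed (ξ ε n) (apertureScale α ε) (closure (K n)) ⊆
      Metric.ball (ξ ε n) (δ₀ * apertureScale α ε)
  ball_subset_ball : ∀ ε ∈ Set.Ioc 0 εStar, ∀ n < N ε,
    Metric.ball (ξ ε n) (δ₀ * apertureScale α ε) ⊆ Metric.ball (ξ ε n) (δ₁ * ε)
  ball_subset_disk : ∀ ε ∈ Set.Ioc 0 εStar, ∀ n < N ε,
    Metric.ball (ξ ε n) (δ₁ * ε) ⊆ Metric.ball 0 R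
  disjoint_circles : ∀ ε ∈ Set.Ioc 0 εStar, ∀ n < N ε, ∀ m < N ε, n ≠ m →
    frontier (Metric.ball (ξ ε n) (δ₁ * ε)) ∩ frontier (Metric.ball (ξ ε m) (δ₁ * ε)) = ∅
  disjoint_boundary : ∀ ε ∈ Set.Ioc 0 εStar, ∀ n < N ε,
    frontier (Metric.ball (ξ ε n) (δ₁ * ε)) ∩ frontier (Metric.ball (0 : E2) R) = ∅

namespace SieveFamily

variable {R δ₀ δ₁ : ℝ}

/-- The scale `r_ε` of the family. -/
def r (P : SieveFamily R δ₀ δ₁) (ε : ℝ) : ℝ := apertureScale P.α ε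

/-- The aperture `K_n^ε = ξ_n^ε + r_ε K_n`. -/
def aperture (P : SieveFamily R δ₀ δ₁) (ε : ℝ) (n : ℕ) : Set E2 :=
  placed (P.ξ ε n) (P.r ε) (P.K n)

/-- The sieve `Γ_ε`: the disk `Σ` without the closures of the apertures. -/
def sieve (P : SieveFamily R δ₀ δ₁) (ε : ℝ) : Set E2 :=
  Metric.ball 0 R \ ⋃ n ∈ Finset.range (P.N ε), closure (P.aperture ε n)

/-- The perforated domain `Ω_ε`: the cylinder `Ω` without the closure of the sieve `Γ_ε`. -/
def domain (P : SieveFamily R δ₀ δ₁) (h ε : ℝ) : Set E3 :=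
  cylinder R h \ closure (inPlane (P.sieve ε))

end SieveFamily

end

noncomputable section

/-! Disjoint disks of equal radius leave room near each of them. -/

/-! Test the Bogovskii constant with the datum `g = sign z`. If `∇ · v = g` and `v` vanishes on the
boundary, all the mass produced in the upper half, `|Σ| h`, must cross the plane `z = 0` through the
apertures, so the flux of `v` there has a fixed size. Small apertures make that expensive: the trace
`u` of `v` on the plane vanishes off disjoint disks of radius `s = δ₀ r_ε`, and this forces `‖u‖² ≤
C s ‖∇v‖²`. By Cauchy–Schwarz on `Σ`, `|Σ| h ≤ C' √s ‖∇v‖`, whence the bound.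

The trace estimate uses no capacity and no count of the apertures. Following oblique segments up to
height `s` and back gives `‖u(· + s a) - u‖² ≤ 20 s ‖∇v‖²` for `‖a‖ ≤ 4`
(`lintegral_trace_translate_le`). By `exists_finset_shift`, a fixed finite set of shifts `a`
suffices to lead every covered point to an uncovered one, where `u = 0`; summing over the shifts
yields `lintegral_sq_trace_le`. The divergence theorem turns this into a flux bound for test fields
(`enorm_setIntegral_div_le`), and density extends it to `H¹₀` (`MemH10.enorm_setIntegral_div_le`).
-/

lemma norm_sub_two_smul_lt {E : Type*} [NormedAddCommGroup E] [InnerProductSpace ℝ E]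
    {s : ℝ} (hs : 0 < s) {c y p : E} (hcp : 2 * s ≤ ‖p - c‖) (hy : ‖y - c‖ ^ 2 ≤ 11 / 10 * s ^ 2)
    (hyp : ‖y - p‖ < s) : ‖(p - c) - (2 : ℝ) • (y - c)‖ < 9 / 20 * s := by
  -- Parallelogram law for `y - c` and `p - y`. The center `p` is thus nearly the reflection of `c`
  -- in `y`: the squared error is below `(2.2 - 4 + 2) s² = 0.2 s²`, and `0.2 < (9 / 20)²`.
  have key : ‖(p - c) - (2 : ℝ) • (y - c)‖ ^ 2
      = 2 * ‖y - c‖ ^ 2 - ‖p - c‖ ^ 2 + 2 * ‖y - p‖ ^ 2 := by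
    have h1 : y - p = (y - c) - (p - c) := by abel
    rw [h1, @norm_sub_sq_real _ _ _ (p - c), @norm_sub_sq_real _ _ _ (y - c), norm_smul,
      inner_smul_right, real_inner_comm]
    norm_num
    ring
  have h4 : 4 * s ^ 2 ≤ ‖p - c‖ ^ 2 := by nlinarith
  have h5 : ‖y - p‖ ^ 2 < s ^ 2 := by
    apply pow_lt_pow_left₀ hyp (norm_nonneg _) (by norm_num)
  apply lt_of_pow_lt_pow_left₀ 2 (by positivity)
  rw [key]
  nlinarith

/-- Two points at distance `s / 2` just outside of a ball of radius `s` are not both covered by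
disjoint balls of radius `s`. -/
lemma exists_uncovered_of_dist {E : Type*} [NormedAddCommGroup E] [InnerProductSpace ℝ E]
    {ι : Type*} {ξ : ι → E} {s : ℝ} (hs : 0 < s)
    (sep : ∀ i j, i ≠ j → 2 * s ≤ ‖ξ i - ξ j‖) (i : ι) {y y' : E}
    (hy : s ^ 2 ≤ ‖y - ξ i‖ ^ 2) (hy2 : ‖y - ξ i‖ ^ 2 ≤ 11 / 10 * s ^ 2)
    (hy' : s ^ 2 ≤ ‖y' - ξ i‖ ^ 2) (hy2' : ‖y' - ξ i‖ ^ 2 ≤ 11 / 10 * s ^ 2)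
    (hyy : ‖y - y'‖ = s / 2) :
    (∀ j, y ∉ Metric.ball (ξ j) s) ∨ (∀ j, y' ∉ Metric.ball (ξ j) s) := by
  by_contra! hcon
  obtain ⟨⟨j, hj⟩, ⟨k, hk⟩⟩ := hcon
  rw [mem_ball_iff_norm] at hj hk
  have hji : j ≠ i := by
    rintro rfl
    have := pow_lt_pow_left₀ hj (norm_nonneg _) two_ne_zero
    linarith
  have hki : k ≠ i := by
    rintro rfl
    have := pow_lt_pow_left₀ hk (norm_nonneg _) two_ne_zero
    linarith
  have h1 := norm_sub_two_smul_lt hs (sep j i hji) hy2 hj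
  have h2 := norm_sub_two_smul_lt hs (sep k i hki) hy2' hk
  have h2y : ‖(2 : ℝ) • (y - y')‖ = s := by
    rw [norm_smul, hyy]; norm_num
    ring
  -- Both centers are within `9 s / 20` of the reflections of `ξ i` in `y` and `y'`, which are `s`
  -- apart. One common center would need `s < 0.9 s`; two distinct ones would be closer than `1.9
  -- s`.
  by_cases hjk : j = k
  · subst hjk
    have h3 : (2 : ℝ) • (y - y') = ((ξ j - ξ i) - (2 : ℝ) • (y' - ξ i))
        - ((ξ j - ξ i) - (2 : ℝ) • (y - ξ i)) := by module
    have h4 := norm_sub_le ((ξ j - ξ i) - (2 : ℝ) • (y' - ξ i))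
        ((ξ j - ξ i) - (2 : ℝ) • (y - ξ i))
    rw [← h3, h2y] at h4
    linarith
  · have h3 : ξ j - ξ k = (2 : ℝ) • (y - y') + (((ξ j - ξ i) - (2 : ℝ) • (y - ξ i))
        - ((ξ k - ξ i) - (2 : ℝ) • (y' - ξ i))) := by module
    have h4 := norm_add_le ((2 : ℝ) • (y - y')) (((ξ j - ξ i) - (2 : ℝ) • (y - ξ i))
        - ((ξ k - ξ i) - (2 : ℝ) • (y' - ξ i)))
    have h5 := norm_sub_le ((ξ j - ξ i) - (2 : ℝ) • (y - ξ i))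
        ((ξ k - ξ i) - (2 : ℝ) • (y' - ξ i))
    rw [← h3, h2y] at h4
    have := sep j k hjk
    linarith

lemma E2_norm_sq (x : E2) : ‖x‖ ^ 2 = x 0 ^ 2 + x 1 ^ 2 := by
  rw [EuclideanSpace.norm_sq_eq, Fin.sum_univ_two, Real.norm_eq_abs, Real.norm_eq_abs, sq_abs,
    sq_abs]

/-- The points `(1, ±1/4)` are `1 / 2` apart with squared norm `1.0625`; a perturbation below `1 /
100` keeps the squared norm between `1` and `1.1`. -/
lemma uncovered_corner {ι : Type*} {ξ : ι → E2} {s : ℝ} (hs : 0 < s)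
    (sep : ∀ i j, i ≠ j → 2 * s ≤ ‖ξ i - ξ j‖) (i : ι) {e : E2} (he : ‖e‖ < 1 / 100) :
    (∀ j, ξ i + s • (!₂[1, 1 / 4] + e) ∉ Metric.ball (ξ j) s) ∨
    (∀ j, ξ i + s • (!₂[1, -1 / 4] + e) ∉ Metric.ball (ξ j) s) := by
  have he2 : e 0 ^ 2 + e 1 ^ 2 < (1 / 100) ^ 2 := by
    rw [← E2_norm_sq]; exact pow_lt_pow_left₀ he (norm_nonneg _) two_ne_zero
  obtain ⟨h0, h0'⟩ := abs_lt_of_sq_lt_sq'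
    (show e 0 ^ 2 < (1 / 100) ^ 2 by nlinarith [sq_nonneg (e 1)])
    (by norm_num)
  obtain ⟨h1, h1'⟩ := abs_lt_of_sq_lt_sq'
    (show e 1 ^ 2 < (1 / 100) ^ 2 by nlinarith [sq_nonneg (e 0)])
    (by norm_num)
  have hs2 : 0 < s ^ 2 := by positivity
  apply exists_uncovered_of_dist hs sep i
  all_goals try
    rw [add_sub_cancel_left, norm_smul, Real.norm_of_nonneg hs.le, mul_pow, E2_norm_sq]
    simp
    nlinarith
  rw [add_sub_add_left_eq_sub, ← smul_sub, norm_smul, Real.norm_of_nonneg hs.le,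
    add_sub_add_right_eq_sub]
  have : ‖(!₂[1, 1 / 4] : E2) - !₂[1, -1 / 4]‖ = 1 / 2 := by
    rw [← sq_eq_sq₀ (norm_nonneg _) (by norm_num), E2_norm_sq]
    simp; norm_num
  rw [this]; ring

/-- There are finitely many shifts, one of which leads from any given point of a family of
disjoint disks of radius `s` to a point that the family does not cover. -/
lemma exists_finset_shift : ∃ A : Finset E2, (∀ a ∈ A, ‖a‖ ≤ 4) ∧
    ∀ {ι : Type} (ξ : ι → E2) (s : ℝ), 0 < s → (∀ i j, i ≠ j → 2 * s ≤ ‖ξ i - ξ j‖) →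
      ∀ i, ∀ x ∈ Metric.ball (ξ i) s, ∃ a ∈ A, ∀ j, x + s • a ∉ Metric.ball (ξ j) s := by
  classical
  -- The rescaled shift from `x` to `ξ i + s (1, 1/4)` has norm at most `1 + 2`. Rounding it to a
  -- finite net costs less than the tolerance `1 / 100`; subtracting `(0, 1/2)` serves the second
  -- point.
  obtain ⟨F, hF, hFf, hcov⟩ :=
    (isCompact_closedBall (0 : E2) 3).finite_cover_balls (e := 1 / 100) (by norm_num)
  have hp : ‖(!₂[1, 1 / 4] : E2)‖ ≤ 2 := by
    rw [← sq_le_sq₀ (norm_nonneg _) (by norm_num), E2_norm_sq]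
    simp; norm_num
  have hb : ‖(!₂[0, 1 / 2] : E2)‖ ≤ 1 := by
    rw [← sq_le_sq₀ (norm_nonneg _) (by norm_num), E2_norm_sq]
    simp; norm_num
  refine ⟨hFf.toFinset ∪ hFf.toFinset.image (fun a => a - !₂[0, 1 / 2]), ?_, ?_⟩
  · intro a ha
    simp only [Finset.mem_union, Set.Finite.mem_toFinset, Finset.mem_image] at ha
    rcases ha with ha | ⟨a, ha, rfl⟩
    · have := hF ha
      rw [mem_closedBall_zero_iff] at this
      linarith
    · have := hF ha
      rw [mem_closedBall_zero_iff] at this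
      linarith [norm_sub_le a !₂[0, 1 / 2]]
  · intro ι ξ s hs sep i x hx
    rw [mem_ball_iff_norm] at hx
    have hq : s⁻¹ • (ξ i - x) + !₂[1, 1 / 4] ∈ Metric.closedBall (0 : E2) 3 := by
      rw [mem_closedBall_zero_iff]
      refine (norm_add_le _ _).trans ?_
      rw [norm_smul, norm_inv, Real.norm_of_nonneg hs.le, norm_sub_rev]
      have : s⁻¹ * ‖x - ξ i‖ ≤ 1 := by
        rw [inv_mul_le_iff₀ hs]; linarith
      linarith
    obtain ⟨a, ha, hqa⟩ := Set.mem_iUnion₂.1 (hcov hq)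
    rw [Metric.mem_ball, dist_comm, dist_eq_norm] at hqa
    have hx1 : x + s • a
        = ξ i + s • (!₂[1, 1 / 4] + (a - (s⁻¹ • (ξ i - x) + !₂[1, 1 / 4]))) := by
      rw [show (!₂[1, 1 / 4] : E2) + (a - (s⁻¹ • (ξ i - x) + !₂[1, 1 / 4]))
        = a - s⁻¹ • (ξ i - x) by abel, smul_sub, smul_smul, mul_inv_cancel₀ hs.ne']
      module
    have hx2 : x + s • (a - !₂[0, 1 / 2])
        = ξ i + s • (!₂[1, -1 / 4] + (a - (s⁻¹ • (ξ i - x) + !₂[1, 1 / 4]))) := by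
      have : (!₂[1, -1 / 4] : E2) = !₂[1, 1 / 4] - !₂[0, 1 / 2] := by
        ext k; fin_cases k <;> norm_num
      rw [this, smul_sub, ← add_sub_assoc, hx1]
      module
    rcases uncovered_corner hs sep i hqa with h | h
    · exact ⟨a, by simp [ha], fun j => hx1 ▸ h j⟩
    · exact ⟨a - !₂[0, 1 / 2], Finset.mem_union_right _ (Finset.mem_image_of_mem _ (by simp [ha])),
        fun j => hx2 ▸ h j⟩

/-- Disks of the same radius with disjoint frontiers have distant centers. -/
lemma two_mul_le_norm_sub_of_disjoint {p q : E2} {ρ : ℝ} (hρ : 0 < ρ)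
    (h : frontier (Metric.ball p ρ) ∩ frontier (Metric.ball q ρ) = ∅) : 2 * ρ ≤ ‖p - q‖ := by
  by_contra! hlt
  rw [frontier_ball _ hρ.ne', frontier_ball _ hρ.ne'] at h
  have hconn : IsPreconnected (Metric.sphere p ρ) :=
    isPreconnected_sphere (by simp [← Module.finrank_eq_rank]) p ρ
  obtain ⟨e, he, hpq⟩ : ∃ e : E2, ‖e‖ = 1 ∧ p - q = ‖p - q‖ • e := by
    by_cases h0 : p - q = 0
    · exact ⟨EuclideanSpace.single 0 1, by simp, by simp [h0]⟩
    · exact ⟨‖p - q‖⁻¹ • (p - q), by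
        rw [norm_smul, norm_inv, norm_norm, inv_mul_cancel₀ (norm_ne_zero_iff.2 h0)], by
        rw [smul_smul, mul_inv_cancel₀ (norm_ne_zero_iff.2 h0), one_smul]⟩
  have hmem : ∀ t : ℝ, |t| = ρ → p + t • e ∈ Metric.sphere p ρ := by
    intro t ht
    simp [norm_smul, he, ht]
  have hval : ∀ t : ℝ, ‖p + t • e - q‖ = |‖p - q‖ + t| := by
    intro t
    rw [add_sub_right_comm, hpq, ← add_smul, norm_smul, he, mul_one, Real.norm_eq_abs, norm_smul,
      he]
    simp
  -- Were the centers closer than `2 ρ`, the distance to `q` along the circle around `p` would pass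
  -- from at most `ρ` to at least `ρ`, so the circles would meet.
  have := hconn.intermediate_value (hmem (-ρ) (by simp [abs_of_pos hρ]))
    (hmem ρ (abs_of_pos hρ)) (f := fun x => ‖x - q‖) (by fun_prop)
  obtain ⟨x, hx, hxq⟩ := this (show ρ ∈ _ by
    rw [Set.mem_Icc, hval, hval]
    exact ⟨abs_le.2 ⟨by linarith [norm_nonneg (p - q)], by linarith⟩,
      le_trans (by linarith [norm_nonneg (p - q)]) (le_abs_self _)⟩)
  exact (Set.eq_empty_iff_forall_notMem.1 h x) ⟨hx, by simpa [dist_eq_norm] using hxq⟩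

/-! Horizontal slices of the space. -/

/-- The point of the space above `x` at height `z`. -/
def slice (x : E2) (z : ℝ) : E3 := !₂[x 0, x 1, z]

@[simp] lemma slice_zero (x : E2) (z : ℝ) : slice x z 0 = x 0 := rfl
@[simp] lemma slice_one (x : E2) (z : ℝ) : slice x z 1 = x 1 := rfl
@[simp] lemma slice_two (x : E2) (z : ℝ) : slice x z 2 = z := rfl

lemma slice_add (x y : E2) (z w : ℝ) : slice (x + y) (z + w) = slice x z + slice y w := by
  ext i; fin_cases i <;> simp [slice]

lemma slice_smul (c : ℝ) (x : E2) (z : ℝ) : slice (c • x) (c * z) = c • slice x z := by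
  ext i; fin_cases i <;> simp [slice]

lemma norm_slice_sq (x : E2) (z : ℝ) : ‖slice x z‖ ^ 2 = ‖x‖ ^ 2 + z ^ 2 := by
  rw [E2_norm_sq, EuclideanSpace.norm_sq_eq, Fin.sum_univ_three]
  simp

lemma continuous_slice : Continuous fun p : E2 × ℝ => slice p.1 p.2 := by
  refine (PiLp.continuous_toLp 2 _).comp (continuous_pi fun i => ?_)
  fin_cases i <;> simp <;> fun_prop

lemma measurableEmbedding_slice : MeasurableEmbedding fun p : E2 × ℝ => slice p.1 p.2 := by
  refine continuous_slice.measurableEmbedding ?_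
  rintro ⟨x, z⟩ ⟨y, w⟩ h
  have h0 := congrArg (fun v : E3 => v 0) h
  have h1 := congrArg (fun v : E3 => v 1) h
  have h2 := congrArg (fun v : E3 => v 2) h
  simp only [slice_zero, slice_one, slice_two] at h0 h1 h2
  refine Prod.ext ?_ h2
  ext i; fin_cases i
  · exact h0
  · exact h1

lemma measurePreserving_slice : MeasurePreserving (fun p : E2 × ℝ => slice p.1 p.2) := by
  have h1 := (volume_preserving_piFinSuccAbove (fun _ : Fin 3 => ℝ) 2).symm
  have h2 : MeasurePreserving (Prod.map id WithLp.ofLp : ℝ × E2 → ℝ × (Fin 2 → ℝ)) :=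
    (MeasurePreserving.id volume).prod (PiLp.volume_preserving_ofLp (Fin 2))
  have h3 : MeasurePreserving (Prod.swap : E2 × ℝ → ℝ × E2) := Measure.measurePreserving_swap
  have h := (PiLp.volume_preserving_toLp (Fin 3)).comp (h1.comp (h2.comp h3))
  convert h using 1
  ext ⟨x, z⟩ i
  fin_cases i <;> rfl

lemma lintegral_eq_lintegral_slice {F : E3 → ℝ≥0∞} (hF : Measurable F) :
    ∫⁻ p, F p = ∫⁻ z : ℝ, ∫⁻ x : E2, F (slice x z) := by
  rw [← measurePreserving_slice.lintegral_comp hF, Measure.volume_eq_prod, lintegral_prod_symm]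
  exact (hF.comp measurePreserving_slice.measurable).aemeasurable

lemma sq_lintegral_le {α : Type*} [MeasurableSpace α] {μ : Measure α} {f : α → ℝ≥0∞}
    (hf : AEMeasurable f μ) : (∫⁻ x, f x ∂μ) ^ 2 ≤ μ Set.univ * ∫⁻ x, f x ^ 2 ∂μ := by
  have h := ENNReal.lintegral_mul_le_Lp_mul_Lq μ Real.HolderConjugate.two_two hf
    (aemeasurable_const (b := (1 : ℝ≥0∞)))
  simp only [Pi.mul_apply, mul_one, lintegral_const, ENNReal.rpow_two] at h
  calc _ ≤ _ := pow_le_pow_left' h 2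
    _ = _ := by
      rw [mul_pow, ← ENNReal.rpow_natCast, ← ENNReal.rpow_natCast, ← ENNReal.rpow_mul,
        ← ENNReal.rpow_mul]
      norm_num [mul_comm]

/-! ### Translation estimates for the trace on the plane `z = 0`. -/

lemma sq_norm_gradField (v : E3 → E3) (x : E3) :
    ‖gradField v x‖ ^ 2 = ∑ i, ∑ j, partialDeriv j (fun y => v y i) x ^ 2 := by
  rw [EuclideanSpace.norm_sq_eq, Fintype.sum_prod_type]
  simp [gradField]

lemma fderiv_apply_eq_sum (f : E3 → ℝ) (x w : E3) :
    fderiv ℝ f x w = ∑ j, w j * partialDeriv j f x := by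
  have hw : w = ∑ j, w j • EuclideanSpace.single j (1 : ℝ) := by
    ext i
    simp [Pi.single_apply]
  conv_lhs => rw [hw, map_sum]
  simp [partialDeriv]

/-- Cauchy–Schwarz on row `i` of the gradient, whose norm is at most the Frobenius norm. -/
lemma abs_fderiv_apply_le (v : E3 → E3) (i : Fin 3) (x w : E3) :
    |fderiv ℝ (fun y => v y i) x w| ≤ ‖w‖ * ‖gradField v x‖ := by
  rw [fderiv_apply_eq_sum]
  apply abs_le_of_sq_le_sq _ (by positivity)
  rw [mul_pow, sq_norm_gradField, EuclideanSpace.norm_sq_eq]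
  simp only [Real.norm_eq_abs, sq_abs]
  refine (Finset.sum_mul_sq_le_sq_mul_sq _ _ _).trans ?_
  refine mul_le_mul_of_nonneg_left ?_ (Finset.sum_nonneg fun j _ => sq_nonneg _)
  exact Finset.single_le_sum (f := fun i => ∑ j, partialDeriv j (fun y => v y i) x ^ 2)
    (fun i _ => Finset.sum_nonneg fun j _ => sq_nonneg _) (Finset.mem_univ i)

lemma ContDiff.component {v : E3 → E3} (hv : ContDiff ℝ ∞ v) (i : Fin 3) :
    ContDiff ℝ ∞ fun y => v y i := by fun_prop

lemma continuous_partialDeriv {f : E3 → ℝ} (hf : ContDiff ℝ ∞ f) (j : Fin 3) :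
    Continuous (partialDeriv j f) :=
  (hf.continuous_fderiv (by simp)).clm_apply continuous_const

lemma continuous_gradField {v : E3 → E3} (hv : ContDiff ℝ ∞ v) : Continuous (gradField v) :=
  (PiLp.continuous_toLp 2 _).comp
    (continuous_pi fun ij => continuous_partialDeriv (ContDiff.component hv ij.1) ij.2)

/-- Squared difference of values along an oblique path between heights `0` and `s`. -/
lemma sq_enorm_slice_sub_le {v : E3 → E3} (hv : ContDiff ℝ ∞ v) (i : Fin 3) {s : ℝ} (hs : 0 < s)
    {b : E2} (hb : ‖b‖ ≤ 2) (x : E2) :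
    ‖v (slice (x + s • b) s) i - v (slice x 0) i‖ₑ ^ 2 ≤
      ENNReal.ofReal (5 * s) * ∫⁻ z in Set.Ioc 0 s, ‖gradField v (slice (x + z • b) z)‖ₑ ^ 2 := by
  set w : E3 := slice b 1
  -- The velocity `(b, 1)` of the path has squared norm at most `4 + 1`; Cauchy–Schwarz over the
  -- height interval supplies the factor `s`.
  have hw : ‖w‖ ^ 2 ≤ 5 := by
    rw [norm_slice_sq]; nlinarith [norm_nonneg b]
  have hpath : ∀ z : ℝ, slice (x + z • b) z = slice x 0 + z • w := by
    intro z
    rw [← slice_smul, ← slice_add, zero_add, mul_one]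
  simp only [hpath]
  have hf := ContDiff.component hv i
  have hline : ∀ z : ℝ, HasDerivAt (fun z => slice x 0 + z • w) w z := by
    intro z
    simpa using ((hasDerivAt_id z).smul_const w).const_add (slice x 0)
  have hd : ∀ z : ℝ, HasDerivAt (fun z => v (slice x 0 + z • w) i)
      (fderiv ℝ (fun y => v y i) (slice x 0 + z • w) w) z := fun z =>
    ((hf.differentiable (by simp) _).hasFDerivAt).comp_hasDerivAt z (hline z)
  have hcl : Continuous fun z : ℝ => slice x 0 + z • w := by fun_prop
  have hcont : Continuous fun z => fderiv ℝ (fun y => v y i) (slice x 0 + z • w) w :=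
    ((hf.continuous_fderiv (by simp)).comp hcl).clm_apply continuous_const
  have hftc := intervalIntegral.integral_eq_sub_of_hasDerivAt (a := 0) (b := s)
    (fun z _ => hd z) (hcont.intervalIntegrable _ _)
  rw [zero_smul, add_zero] at hftc
  rw [← hftc, intervalIntegral.integral_of_le hs.le]
  have hm : Continuous fun z => ‖gradField v (slice x 0 + z • w)‖ₑ :=
    ((continuous_gradField hv).comp hcl).enorm
  calc _ ≤ (∫⁻ z in Set.Ioc 0 s, ‖w‖ₑ * ‖gradField v (slice x 0 + z • w)‖ₑ) ^ 2 := by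
        gcongr
        refine (enorm_integral_le_lintegral_enorm _).trans (lintegral_mono fun z => ?_)
        rw [← ofReal_norm, ← ofReal_norm, ← ofReal_norm,
          ← ENNReal.ofReal_mul (norm_nonneg _)]
        exact ENNReal.ofReal_le_ofReal (abs_fderiv_apply_le v i _ w)
    _ = ‖w‖ₑ ^ 2 * (∫⁻ z in Set.Ioc 0 s, ‖gradField v (slice x 0 + z • w)‖ₑ) ^ 2 := by
        rw [lintegral_const_mul _ hm.measurable, mul_pow]
    _ ≤ ENNReal.ofReal 5 * (ENNReal.ofReal s *
          ∫⁻ z in Set.Ioc 0 s, ‖gradField v (slice x 0 + z • w)‖ₑ ^ 2) := by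
        gcongr
        · rw [← ofReal_norm, ← ENNReal.ofReal_pow (norm_nonneg _)]
          exact ENNReal.ofReal_le_ofReal hw
        · refine (sq_lintegral_le hm.measurable.aemeasurable).trans_eq ?_
          simp
    _ = _ := by
        rw [← mul_assoc, ENNReal.ofReal_mul (by norm_num)]

/-- After exchanging the integrals, the displacement `z • b` at each height is a translation of the
plane and disappears, so the oblique paths together sweep the slab `0 < z ≤ s` once. -/
lemma lintegral_slice_sub_le {v : E3 → E3} (hv : ContDiff ℝ ∞ v) (i : Fin 3) {s : ℝ} (hs : 0 < s)
    {b : E2} (hb : ‖b‖ ≤ 2) :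
    ∫⁻ x : E2, ‖v (slice (x + s • b) s) i - v (slice x 0) i‖ₑ ^ 2 ≤
      ENNReal.ofReal (5 * s) * ∫⁻ p, ‖gradField v p‖ₑ ^ 2 := by
  have hg : Continuous fun p => ‖gradField v p‖ₑ ^ 2 :=
    (ENNReal.continuous_pow 2).comp (continuous_gradField hv).enorm
  calc _ ≤ ∫⁻ x : E2, ENNReal.ofReal (5 * s) *
          ∫⁻ z in Set.Ioc 0 s, ‖gradField v (slice (x + z • b) z)‖ₑ ^ 2 :=
        lintegral_mono fun x => sq_enorm_slice_sub_le hv i hs hb x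
    _ = ENNReal.ofReal (5 * s) * ∫⁻ x : E2,
          ∫⁻ z in Set.Ioc 0 s, ‖gradField v (slice (x + z • b) z)‖ₑ ^ 2 :=
        lintegral_const_mul' _ _ ENNReal.ofReal_ne_top
    _ = ENNReal.ofReal (5 * s) * ∫⁻ z in Set.Ioc 0 s,
          ∫⁻ x : E2, ‖gradField v (slice (x + z • b) z)‖ₑ ^ 2 := by
        rw [lintegral_lintegral_swap]
        refine Continuous.aemeasurable ?_
        exact hg.comp (continuous_slice.comp (by fun_prop :
          Continuous fun p : E2 × ℝ => (p.1 + p.2 • b, p.2)))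
    _ = ENNReal.ofReal (5 * s) * ∫⁻ z in Set.Ioc 0 s,
          ∫⁻ x : E2, ‖gradField v (slice x z)‖ₑ ^ 2 := by
        congr 1
        refine lintegral_congr fun z => ?_
        exact lintegral_add_right_eq_self (fun x => ‖gradField v (slice x z)‖ₑ ^ 2) (z • b)
    _ ≤ ENNReal.ofReal (5 * s) * ∫⁻ z, ∫⁻ x : E2, ‖gradField v (slice x z)‖ₑ ^ 2 := by
        gcongr
        exact Measure.restrict_le_self
    _ = _ := by
        rw [← lintegral_eq_lintegral_slice hg.measurable]

lemma sq_enorm_sub_le (a b m : ℝ) : ‖a - b‖ₑ ^ 2 ≤ 2 * ‖m - b‖ₑ ^ 2 + 2 * ‖m - a‖ₑ ^ 2 := by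
  have h : ∀ x : ℝ, ‖x‖ₑ ^ 2 = ENNReal.ofReal (x ^ 2) := fun x => by
    rw [← ofReal_norm, ← ENNReal.ofReal_pow (norm_nonneg _), Real.norm_eq_abs, sq_abs]
  rw [h, h, h, show (2 : ℝ≥0∞) = ENNReal.ofReal 2 by simp, ← ENNReal.ofReal_mul (by norm_num),
    ← ENNReal.ofReal_mul (by norm_num), ← ENNReal.ofReal_add (by positivity) (by positivity)]
  apply ENNReal.ofReal_le_ofReal
  nlinarith [sq_nonneg (m - b + (m - a))]

/-- The trace on the plane `z = 0` has half a derivative, measured by translations. -/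
lemma lintegral_trace_translate_le {v : E3 → E3} (hv : ContDiff ℝ ∞ v) (i : Fin 3) {s : ℝ}
    (hs : 0 < s) {a : E2} (ha : ‖a‖ ≤ 4) :
    ∫⁻ x : E2, ‖v (slice (x + s • a) 0) i - v (slice x 0) i‖ₑ ^ 2 ≤
      ENNReal.ofReal (20 * s) * ∫⁻ p, ‖gradField v p‖ₑ ^ 2 := by
  -- The paths from `x` along `b = a / 2` and from `x + s • a` along `-b` meet at height `s` above
  -- the midpoint. Each contributes `2 · 5 s`.
  have hb : ‖(2⁻¹ : ℝ) • a‖ ≤ 2 := by rw [norm_smul]; norm_num; linarith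
  have hb' : ‖-((2⁻¹ : ℝ) • a)‖ ≤ 2 := by rwa [norm_neg]
  set b := (2⁻¹ : ℝ) • a
  have hab : ∀ x : E2, x + s • a + s • -b = x + s • b := by
    intro x; simp only [b]; module
  have hvc : ∀ z : ℝ, Continuous fun x : E2 => v (slice x z) i := fun z =>
    (ContDiff.component hv i).continuous.comp
      (continuous_slice.comp (by fun_prop : Continuous fun x : E2 => (x, z)))
  have hpt : ∀ x : E2, ‖v (slice (x + s • a) 0) i - v (slice x 0) i‖ₑ ^ 2 ≤
      2 * ‖v (slice (x + s • b) s) i - v (slice x 0) i‖ₑ ^ 2 +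
      2 * ‖v (slice (x + s • a + s • -b) s) i - v (slice (x + s • a) 0) i‖ₑ ^ 2 := by
    intro x
    rw [hab]
    exact sq_enorm_sub_le _ _ _
  calc _ ≤ ∫⁻ x : E2, (2 * ‖v (slice (x + s • b) s) i - v (slice x 0) i‖ₑ ^ 2 +
      2 * ‖v (slice (x + s • a + s • -b) s) i - v (slice (x + s • a) 0) i‖ₑ ^ 2) :=
        lintegral_mono hpt
    _ = 2 * (∫⁻ x : E2, ‖v (slice (x + s • b) s) i - v (slice x 0) i‖ₑ ^ 2) +
        2 * ∫⁻ x : E2, ‖v (slice (x + s • -b) s) i - v (slice x 0) i‖ₑ ^ 2 := by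
        rw [lintegral_add_left, lintegral_const_mul' _ _ (by simp),
          lintegral_const_mul' _ _ (by simp)]
        · rw [lintegral_add_right_eq_self
            (fun x => ‖v (slice (x + s • -b) s) i - v (slice x 0) i‖ₑ ^ 2) (s • a)]
        · have := (((hvc s).comp (continuous_add_const (s • b))).sub (hvc 0)).enorm
          exact (this.measurable.pow_const 2).const_mul _
    _ ≤ 2 * (ENNReal.ofReal (5 * s) * ∫⁻ p, ‖gradField v p‖ₑ ^ 2) +
        2 * (ENNReal.ofReal (5 * s) * ∫⁻ p, ‖gradField v p‖ₑ ^ 2) := by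
        gcongr
        · exact lintegral_slice_sub_le hv i hs hb
        · exact lintegral_slice_sub_le hv i hs hb'
    _ = _ := by
        rw [← two_mul, ← mul_assoc, ← mul_assoc, show (2 : ℝ≥0∞) * 2 = ENNReal.ofReal 4 by norm_num,
          ← ENNReal.ofReal_mul (by norm_num)]
        congr 2; ring

/-- A trace that vanishes off a set `U`, each point of which a shift from `A` leads out of `U`,
is controlled by the gradient. -/
lemma lintegral_sq_trace_le {v : E3 → E3} (hv : ContDiff ℝ ∞ v) (i : Fin 3) {s : ℝ}
    (hs : 0 < s) {A : Finset E2} (hA : ∀ a ∈ A, ‖a‖ ≤ 4) {U : Set E2}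
    (hU : ∀ x ∈ U, ∃ a ∈ A, x + s • a ∉ U) (hvU : ∀ x ∉ U, v (slice x 0) i = 0) :
    ∫⁻ x : E2, ‖v (slice x 0) i‖ₑ ^ 2 ≤
      A.card * (ENNReal.ofReal (20 * s) * ∫⁻ p, ‖gradField v p‖ₑ ^ 2) := by
  have hvc : Continuous fun x : E2 => v (slice x 0) i :=
    (ContDiff.component hv i).continuous.comp
      (continuous_slice.comp (by fun_prop : Continuous fun x : E2 => (x, (0 : ℝ))))
  calc _ ≤ ∫⁻ x : E2, ∑ a ∈ A, ‖v (slice (x + s • a) 0) i - v (slice x 0) i‖ₑ ^ 2 := by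
        refine lintegral_mono fun x => ?_
        -- The good shift depends on `x`; summing over all of `A` avoids having to select it
        -- measurably.
        by_cases hx : x ∈ U
        · obtain ⟨a, ha, hxa⟩ := hU x hx
          calc ‖v (slice x 0) i‖ₑ ^ 2
              = ‖v (slice (x + s • a) 0) i - v (slice x 0) i‖ₑ ^ 2 := by
                rw [hvU _ hxa, zero_sub, enorm_neg]
            _ ≤ _ := Finset.single_le_sum
                (f := fun a => ‖v (slice (x + s • a) 0) i - v (slice x 0) i‖ₑ ^ 2)
                (fun _ _ => zero_le) ha
        · simp [hvU x hx]
    _ = ∑ a ∈ A, ∫⁻ x : E2, ‖v (slice (x + s • a) 0) i - v (slice x 0) i‖ₑ ^ 2 := by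
        rw [lintegral_finsetSum]
        intro a _
        exact ((hvc.comp (continuous_add_const (s • a))).sub hvc).enorm.measurable.pow_const 2
    _ ≤ ∑ a ∈ A, (ENNReal.ofReal (20 * s) * ∫⁻ p, ‖gradField v p‖ₑ ^ 2) :=
        Finset.sum_le_sum fun a ha => lintegral_trace_translate_le hv i hs (hA a ha)
    _ = _ := by rw [Finset.sum_const, nsmul_eq_mul]

/-! The flux of a compactly supported field through the plane `z = 0`. -/

lemma measurableSet_upper : MeasurableSet {p : E3 | 0 < p 2} :=
  (isOpen_lt continuous_const (by fun_prop)).measurableSet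

lemma integrable_partialDeriv {f : E3 → ℝ} (hf : ContDiff ℝ ∞ f) (hc : HasCompactSupport f)
    (j : Fin 3) : Integrable (partialDeriv j f) := by
  refine (continuous_partialDeriv hf j).integrable_of_hasCompactSupport ?_
  exact (hc.fderiv (𝕜 := ℝ)).comp_left (g := fun L : E3 →L[ℝ] ℝ => L (EuclideanSpace.single j 1))
    rfl

/-- A horizontal derivative has zero integral over the upper half space. -/
lemma setIntegral_upper_partialDeriv_eq_zero {f : E3 → ℝ} (hf : ContDiff ℝ ∞ f)
    (hc : HasCompactSupport f) {j : Fin 3} (hj : j ≠ 2) :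
    ∫ p in {p : E3 | 0 < p 2}, partialDeriv j f p = 0 := by
  -- The indicator jumps only across `z = 0`, so its derivative in a horizontal direction exists and
  -- is zero: integration by parts on the whole space leaves no boundary term.
  set χ : E3 → ℝ := Set.indicator {p : E3 | 0 < p 2} 1
  have hmul : ∀ F : E3 → ℝ, (fun p => ContinuousLinearMap.mul ℝ ℝ (χ p) (F p))
      = Set.indicator {p : E3 | 0 < p 2} F := by
    intro F; ext p
    by_cases hp : p ∈ {p : E3 | 0 < p 2} <;> simp [χ, hp]
  have h := integral_bilinear_hasLineDerivAt_right_eq_neg_left_of_integrable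
    (μ := (volume : Measure E3)) (B := ContinuousLinearMap.mul ℝ ℝ) (f := χ) (f' := fun _ => 0)
    (g := f) (g' := partialDeriv j f) (v := EuclideanSpace.single j 1) (by simp)
    (by rw [hmul]; exact (integrable_partialDeriv hf hc j).indicator measurableSet_upper)
    (by
      rw [hmul]
      exact (hf.continuous.integrable_of_hasCompactSupport hc).indicator measurableSet_upper)
    (fun p _ => by
      have : (fun t : ℝ => χ (p + t • EuclideanSpace.single j 1)) = fun _ => χ p := by
        ext t
        simp [χ, Set.indicator, hj.symm]
      unfold HasLineDerivAt
      rw [this]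
      exact hasDerivAt_const _ _)
    (fun p _ => ((hf.differentiable (by simp) p).hasFDerivAt).hasLineDerivAt _)
  rw [hmul, integral_indicator measurableSet_upper] at h
  simpa using h

lemma hasDerivAt_slice (f : E3 → ℝ) (hf : ContDiff ℝ ∞ f) (x : E2) (z : ℝ) :
    HasDerivAt (fun z => f (slice x z)) (partialDeriv 2 f (slice x z)) z := by
  have hs : ∀ z, slice x z = slice x 0 + z • (EuclideanSpace.single 2 1 : E3) := by
    intro z; ext i; fin_cases i <;> simp [slice]
  have hline : HasDerivAt (fun z => slice x z) (EuclideanSpace.single 2 1) z := by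
    rw [funext hs]
    simpa using ((hasDerivAt_id z).smul_const
      (EuclideanSpace.single 2 1 : E3)).const_add (slice x 0)
  exact ((hf.differentiable (by simp) _).hasFDerivAt).comp_hasDerivAt z hline

lemma contDiff_slice (x : E2) : ContDiff ℝ ∞ fun z : ℝ => slice x z := by
  rw [contDiff_euclidean]
  intro i; fin_cases i <;> simp [slice] <;> fun_prop

/-- Fubini reduces this to the fundamental theorem of calculus on each vertical half-line, where
compact support removes the end at infinity. -/
lemma setIntegral_upper_partialDeriv_two {f : E3 → ℝ} (hf : ContDiff ℝ ∞ f)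
    (hc : HasCompactSupport f) :
    ∫ p in {p : E3 | 0 < p 2}, partialDeriv 2 f p = - ∫ x : E2, f (slice x 0) := by
  have hpre : (fun p : E2 × ℝ => slice p.1 p.2) ⁻¹' {p : E3 | 0 < p 2}
      = Set.univ ×ˢ Set.Ioi 0 := by
    ext ⟨x, z⟩; simp
  rw [← measurePreserving_slice.setIntegral_preimage_emb measurableEmbedding_slice, hpre,
    Measure.volume_eq_prod, setIntegral_prod, Measure.restrict_univ, ← integral_neg]
  · refine integral_congr_ae (.of_forall fun x => ?_)
    have hcs : HasCompactSupport fun z : ℝ => f (slice x z) := by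
      obtain ⟨M, hM⟩ := hc.isCompact.isBounded.subset_closedBall 0
      refine HasCompactSupport.intro (isCompact_Icc (a := -M) (b := M)) fun z hz => ?_
      by_contra hne
      have := hM (subset_tsupport f hne)
      rw [mem_closedBall_zero_iff] at this
      exact hz (abs_le.1 ((PiLp.norm_apply_le (slice x z) 2).trans this))
    have := hcs.integral_Ioi_deriv_eq ((hf.comp (contDiff_slice x)).of_le (by simp)) 0
    have hd : deriv (f ∘ fun z => slice x z) = fun z => partialDeriv 2 f (slice x z) :=
      funext fun z => (hasDerivAt_slice f hf x z).deriv
    rwa [hd] at this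
  · exact ((measurePreserving_slice.integrable_comp_emb measurableEmbedding_slice).2
      (integrable_partialDeriv hf hc 2)).integrableOn

lemma setIntegral_upper_div {v : E3 → E3} (hv : ContDiff ℝ ∞ v) (hc : HasCompactSupport v) :
    ∫ p in {p : E3 | 0 < p 2}, ∑ i, gradField v p (i, i) = - ∫ x : E2, v (slice x 0) 2 := by
  have hci : ∀ i, HasCompactSupport fun y => v y i := fun i =>
    hc.comp_left (g := fun w : E3 => w i) rfl
  have hi := fun i => ContDiff.component hv i
  change ∫ p in {p : E3 | 0 < p 2}, ∑ i, partialDeriv i (fun y => v y i) p = _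
  rw [integral_finsetSum _ fun i _ => (integrable_partialDeriv (hi i) (hci i) i).integrableOn,
    Fin.sum_univ_three,
    setIntegral_upper_partialDeriv_eq_zero (hi 0) (hci 0) (by decide),
    setIntegral_upper_partialDeriv_eq_zero (hi 1) (hci 1) (by decide),
    setIntegral_upper_partialDeriv_two (hi 2) (hci 2), zero_add, zero_add]

lemma gradField_eq_zero {v : E3 → E3} {x : E3} (hx : x ∉ tsupport v) : gradField v x = 0 := by
  have h0 := notMem_tsupport_iff_eventuallyEq.1 hx
  ext ij
  have h1 : (fun y => v y ij.1) =ᶠ[nhds x] fun _ => 0 := by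
    filter_upwards [h0] with y hy
    simp [hy]
  simp [gradField, partialDeriv, h1.fderiv_eq]

lemma sq_eLpNorm_two {α F : Type*} [MeasurableSpace α] [NormedAddCommGroup F] (f : α → F)
    (μ : Measure α) : eLpNorm f 2 μ ^ 2 = ∫⁻ x, ‖f x‖ₑ ^ 2 ∂μ := by
  have := eLpNorm_nnreal_pow_eq_lintegral (f := f) (μ := μ) (p := 2) (by norm_num)
  simpa using this

/-- The flux of a test field through the holes of a sieve in the plane `z = 0`. -/
lemma enorm_setIntegral_div_le {Q : Set E3} {v : E3 → E3}
    (hv : IsTestFunction Q v) {s : ℝ} (hs : 0 < s) {A : Finset E2} (hA : ∀ a ∈ A, ‖a‖ ≤ 4)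
    {U B : Set E2} (hU : ∀ x ∈ U, ∃ a ∈ A, x + s • a ∉ U)
    (hQU : ∀ x, slice x 0 ∈ Q → x ∈ U ∩ B) :
    ‖∫ p in Q ∩ {p : E3 | 0 < p 2}, ∑ i, gradField v p (i, i)‖ₑ ≤
      (volume B * (A.card * ENNReal.ofReal (20 * s))) ^ (2⁻¹ : ℝ) *
        eLpNorm (gradField v) 2 (volume.restrict Q) := by
  have hoff : ∀ p, p ∉ Q → v p = 0 := fun p hp =>
    image_eq_zero_of_notMem_tsupport fun h => hp (hv.support_subset h)
  have hgoff : ∀ p, p ∉ Q → gradField v p = 0 := fun p hp =>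
    gradField_eq_zero fun h => hp (hv.support_subset h)
  have h1 : ∫ p in Q ∩ {p : E3 | 0 < p 2}, ∑ i, gradField v p (i, i)
      = - ∫ x : E2, v (slice x 0) 2 := by
    rw [← setIntegral_upper_div hv.smooth hv.compact, Set.inter_comm]
    refine (setIntegral_eq_of_subset_of_forall_sdiff_eq_zero measurableSet_upper
      Set.inter_subset_left fun p hp => ?_).symm
    simp [hgoff p fun h => hp.2 ⟨hp.1, h⟩]
  have h2 : ∫⁻ p, ‖gradField v p‖ₑ ^ 2 = eLpNorm (gradField v) 2 (volume.restrict Q) ^ 2 := by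
    rw [sq_eLpNorm_two, setLIntegral_eq_of_support_subset]
    intro p hp
    by_contra h
    exact hp (by simp [hgoff p h])
  have h3 := lintegral_sq_trace_le hv.smooth 2 hs hA hU fun x hx => by
    rw [hoff _ fun h => hx (hQU x h).1]; rfl
  have hcont : Continuous fun x : E2 => v (slice x 0) 2 :=
    (ContDiff.component hv.smooth 2).continuous.comp
      (continuous_slice.comp (by fun_prop : Continuous fun x : E2 => (x, (0 : ℝ))))
  -- Confining the trace to `B` lets Cauchy–Schwarz cost only `volume B`, whatever the number of
  -- holes in `U`.
  have h4 : ∫ x : E2, v (slice x 0) 2 = ∫ x in B, v (slice x 0) 2 := by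
    refine (setIntegral_eq_integral_of_forall_compl_eq_zero fun x hx => ?_).symm
    rw [hoff _ fun h => hx (hQU x h).2]; rfl
  rw [h1, enorm_neg, h4]
  rw [← ENNReal.rpow_le_rpow_iff (z := 2) (by norm_num),
    ENNReal.mul_rpow_of_nonneg _ _ (by norm_num),
    ← ENNReal.rpow_mul]
  rw [show (2⁻¹ : ℝ) * 2 = 1 by norm_num, ENNReal.rpow_one, ENNReal.rpow_two, ENNReal.rpow_two]
  calc _ ≤ (∫⁻ x in B, ‖v (slice x 0) 2‖ₑ) ^ 2 := by
        gcongr; exact enorm_integral_le_lintegral_enorm _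
    _ ≤ volume B * ∫⁻ x in B, ‖v (slice x 0) 2‖ₑ ^ 2 := by
        simpa using sq_lintegral_le (μ := volume.restrict B) hcont.enorm.measurable.aemeasurable
    _ ≤ volume B * ∫⁻ x, ‖v (slice x 0) 2‖ₑ ^ 2 := by
        gcongr; exact Measure.restrict_le_self
    _ ≤ _ := by
        grw [h3, h2]
        simp only [mul_assoc]; exact le_rfl

lemma enorm_trace_le (M : Mat3) : ‖∑ i : Fin 3, M (i, i)‖ₑ ≤ 3 * ‖M‖ₑ := by
  refine (enorm_sum_le _ _).trans ?_
  refine (Finset.sum_le_card_nsmul _ _ ‖M‖ₑ fun i _ => ?_).trans (by simp)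
  rw [← ofReal_norm, ← ofReal_norm]
  exact ENNReal.ofReal_le_ofReal (PiLp.norm_apply_le M (i, i))

/-- A bound for the divergence of test fields extends to `H¹₀`. -/
lemma MemH10.enorm_setIntegral_div_le {Q D : Set E3} (hQ : volume Q ≠ ⊤) {v : E3 → E3}
    {G : E3 → Mat3} (hv : MemH10 Q v G) {c : ℝ≥0∞} (hc : c ≠ ⊤)
    (h : ∀ φ : E3 → E3, IsTestFunction Q φ → ‖∫ p in Q ∩ D, ∑ i, gradField φ p (i, i)‖ₑ ≤
      c * eLpNorm (gradField φ) 2 (volume.restrict Q)) :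
    ‖∫ p in Q ∩ D, ∑ i, G p (i, i)‖ₑ ≤ c * eLpNorm G 2 (volume.restrict Q) := by
  obtain ⟨φ, hφ, -, hlim⟩ := hv.approx
  have hGm := hv.memH1.memLp_grad
  have hfin : IsFiniteMeasure (volume.restrict Q) := ⟨by simpa using hQ.lt_top⟩
  set μ := volume.restrict Q
  set e := fun k => eLpNorm (fun x => gradField (φ k) x - G x) 2 μ
  have hle : volume.restrict (Q ∩ D) ≤ μ := Measure.restrict_mono Set.inter_subset_left le_rfl
  have hφm : ∀ k, AEStronglyMeasurable (gradField (φ k)) μ := fun k =>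
    (continuous_gradField (hφ k).smooth).aestronglyMeasurable
  have hint : ∀ F : E3 → Mat3, MemLp F 2 μ →
      Integrable (fun p => ∑ i, F p (i, i)) (volume.restrict (Q ∩ D)) := by
    intro F hF
    refine integrable_finsetSum _ fun i _ => ?_
    have h1 : Integrable F μ := hF.integrable (by norm_num)
    refine Integrable.mono_measure ?_ hle
    exact (EuclideanSpace.proj (i, i) : Mat3 →L[ℝ] ℝ).integrable_comp h1
  have hφG : ∀ k, MemLp (gradField (φ k)) 2 μ := by
    intro k
    refine MemLp.restrict _ ((continuous_gradField (hφ k).smooth).memLp_of_hasCompactSupport ?_)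
    exact HasCompactSupport.intro (hφ k).compact fun x hx => gradField_eq_zero hx
  -- Replacing `G` by the gradient of `φ k` raises the norm by at most `e k` and changes the
  -- integral by an `L¹` error, which Hölder bounds by `e k` since `Q` has finite measure.
  have hstep : ∀ k, ‖∫ p in Q ∩ D, ∑ i, G p (i, i)‖ₑ ≤
      c * (e k + eLpNorm G 2 μ) + 3 * (e k * μ Set.univ ^ (2⁻¹ : ℝ)) := by
    intro k
    have hdiff : ∫ p in Q ∩ D, ∑ i, G p (i, i) = (∫ p in Q ∩ D, ∑ i, gradField (φ k) p (i, i))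
        - ∫ p in Q ∩ D, ∑ i, (gradField (φ k) p - G p) (i, i) := by
      rw [← integral_sub (hint _ (hφG k))
        (hint (fun p => gradField (φ k) p - G p) ((hφG k).sub hGm))]
      refine integral_congr_ae (.of_forall fun p => ?_)
      simp
    rw [hdiff]
    refine (enorm_sub_le).trans (add_le_add ((h _ (hφ k)).trans ?_) ?_)
    · gcongr
      have : gradField (φ k) = (fun x => gradField (φ k) x - G x) + G := by ext1 x; simp
      conv_lhs => rw [this]
      exact eLpNorm_add_le ((hφm k).sub hGm.1) hGm.1 (by norm_num)
    · calc _ ≤ ∫⁻ p in Q ∩ D, ‖∑ i, (gradField (φ k) p - G p) (i, i)‖ₑ :=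
            enorm_integral_le_lintegral_enorm _
        _ ≤ ∫⁻ p, 3 * ‖gradField (φ k) p - G p‖ₑ ∂μ :=
            lintegral_mono' hle fun p => enorm_trace_le _
        _ = 3 * eLpNorm (fun x => gradField (φ k) x - G x) 1 μ := by
            rw [lintegral_const_mul' _ _ (by simp), eLpNorm_one_eq_lintegral_enorm]
        _ ≤ _ := by
            gcongr
            refine (eLpNorm_le_eLpNorm_mul_rpow_measure_univ (q := 2) (by norm_num)
              ((hφm k).sub hGm.1)).trans_eq ?_
            norm_num [e]
            rfl
  have hlim2 : Filter.Tendsto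
      (fun k => c * (e k + eLpNorm G 2 μ) + 3 * (e k * μ Set.univ ^ (2⁻¹ : ℝ))) Filter.atTop
      (nhds (c * (0 + eLpNorm G 2 μ) + 3 * (0 * μ Set.univ ^ (2⁻¹ : ℝ)))) := by
    refine .add (ENNReal.Tendsto.const_mul (hlim.add tendsto_const_nhds) (.inr hc))
      (ENNReal.Tendsto.const_mul (ENNReal.Tendsto.mul_const hlim (.inr ?_)) (.inr (by simp)))
    exact ENNReal.rpow_ne_top_of_nonneg (by norm_num) (measure_ne_top _ _)
  simpa using ge_of_tendsto' hlim2 hstep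

/-! The perforated cylinder. -/

lemma E2_eta (x : E2) : (!₂[x 0, x 1] : E2) = x := by
  ext i; fin_cases i <;> rfl

lemma mem_ball_zero_iff_sq {R : ℝ} (hR : 0 < R) (x : E2) :
    x ∈ Metric.ball (0 : E2) R ↔ x 0 ^ 2 + x 1 ^ 2 < R ^ 2 := by
  rw [mem_ball_zero_iff, ← E2_norm_sq, sq_lt_sq₀ (norm_nonneg _) hR.le]

lemma volume_slice_image {S : Set E3} (hS : MeasurableSet S) {B : Set E2} {I : Set ℝ}
    (h : ∀ x z, slice x z ∈ S ↔ x ∈ B ∧ z ∈ I) : volume S = volume B * volume I := by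
  rw [← measurePreserving_slice.measure_preimage hS.nullMeasurableSet]
  have : (fun p : E2 × ℝ => slice p.1 p.2) ⁻¹' S = B ×ˢ I := by
    ext ⟨x, z⟩; exact h x z
  rw [this, Measure.volume_eq_prod, Measure.prod_prod]

lemma volume_plane : volume {p : E3 | p 2 = 0} = 0 := by
  have hm : MeasurableSet {p : E3 | p 2 = 0} :=
    (isClosed_eq (by fun_prop) continuous_const).measurableSet
  rw [volume_slice_image hm (B := Set.univ) (I := {0}) (by simp)]
  simp

lemma isOpen_cylinder (R h : ℝ) : IsOpen (cylinder R h) :=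
  (isOpen_lt (f := fun x : E3 => x 0 ^ 2 + x 1 ^ 2) (by fun_prop) continuous_const).inter
    ((isOpen_lt (g := fun x : E3 => x 2) continuous_const (by fun_prop)).inter
      (isOpen_lt (f := fun x : E3 => x 2) (by fun_prop) continuous_const))

lemma closure_inPlane_subset (S : Set E2) : closure (inPlane S) ⊆ {p : E3 | p 2 = 0} :=
  closure_minimal (fun _ hp => hp.2) (isClosed_eq (by fun_prop) continuous_const)

/-- The closed sieve lies in a null plane, so volumes and integrals may be computed on the full
cylinder. -/
lemma ae_eq_cylinder (R h : ℝ) (S : Set E2) :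
    (cylinder R h \ closure (inPlane S) : Set E3) =ᵐ[volume] cylinder R h :=
  sdiff_null_ae_eq_self (measure_mono_null (closure_inPlane_subset S) volume_plane)

/-- The function `sign z`, up to its value on the plane `z = 0`. -/
def heightSign (p : E3) : ℝ := if 0 < p 2 then 1 else -1

lemma enorm_heightSign (p : E3) : ‖heightSign p‖ₑ = 1 := by
  unfold heightSign; split_ifs <;> simp

lemma measurable_heightSign : Measurable heightSign :=
  Measurable.ite measurableSet_upper measurable_const measurable_const

section

variable {R h : ℝ}

lemma volume_cylinder (hR : 0 < R) :
    volume (cylinder R h) = volume (Metric.ball (0 : E2) R) * ENNReal.ofReal (2 * h) := by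
  rw [volume_slice_image (isOpen_cylinder R h).measurableSet (B := Metric.ball 0 R)
    (I := Set.Ioo (-h) h), Real.volume_Ioo]
  · ring_nf
  · intro x z; simp [_root_.cylinder, mem_ball_zero_iff_sq hR]

lemma volume_cylinder_upper (hR : 0 < R) :
    volume (cylinder R h ∩ {p | 0 < p 2}) =
      volume (Metric.ball (0 : E2) R) * ENNReal.ofReal h := by
  rw [volume_slice_image ((isOpen_cylinder R h).measurableSet.inter measurableSet_upper)
    (B := Metric.ball 0 R) (I := Set.Ioo 0 h), Real.volume_Ioo, sub_zero]
  intro x z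
  simp only [_root_.cylinder, mem_ball_zero_iff_sq hR, Set.mem_inter_iff, Set.mem_ofPred_eq,
    slice_zero,
    slice_one, slice_two, Set.mem_Ioo]
  constructor
  · rintro ⟨⟨h1, -, h2⟩, h3⟩; exact ⟨h1, h3, h2⟩
  · rintro ⟨h1, h3, h2⟩; exact ⟨⟨h1, by linarith, h2⟩, h3⟩

lemma volume_cylinder_lower (hR : 0 < R) (hh : 0 < h) :
    volume (cylinder R h \ {p | 0 < p 2}) =
      volume (Metric.ball (0 : E2) R) * ENNReal.ofReal h := by
  rw [volume_slice_image ((isOpen_cylinder R h).measurableSet.diff measurableSet_upper)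
    (B := Metric.ball 0 R) (I := Set.Ioc (-h) 0), Real.volume_Ioc, sub_neg_eq_add, zero_add]
  intro x z
  simp only [_root_.cylinder, mem_ball_zero_iff_sq hR, Set.mem_sdiff, Set.mem_ofPred_eq, slice_zero,
    slice_one, slice_two, Set.mem_Ioc, not_lt]
  constructor
  · rintro ⟨⟨h1, h2, -⟩, h3⟩; exact ⟨h1, h2, h3⟩
  · rintro ⟨h1, h2, h3⟩; exact ⟨⟨h1, h2, by linarith⟩, h3⟩

lemma volume_cylinder_ne_top (hR : 0 < R) : volume (cylinder R h) ≠ ⊤ := by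
  rw [volume_cylinder hR]
  exact ENNReal.mul_ne_top measure_ball_lt_top.ne ENNReal.ofReal_ne_top

lemma setIntegral_heightSign (hR : 0 < R) (hh : 0 < h) :
    ∫ p in cylinder R h, heightSign p = 0 := by
  have hfin := volume_cylinder_ne_top (h := h) hR
  have hi : IntegrableOn heightSign (cylinder R h) := by
    refine Measure.integrableOn_of_bounded (M := 1) hfin
      measurable_heightSign.aestronglyMeasurable (.of_forall fun p => ?_)
    unfold heightSign; split_ifs <;> simp
  have hm := (isOpen_cylinder R h).measurableSet
  rw [← integral_inter_add_sdiff measurableSet_upper hi,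
    setIntegral_congr_fun (g := fun _ => 1) (hm.inter measurableSet_upper)
      (fun p hp => show heightSign p = 1 from if_pos hp.2),
    setIntegral_congr_fun (g := fun _ => -1) (hm.diff measurableSet_upper)
      (fun p hp => show heightSign p = -1 from if_neg hp.2)]
  simp [Measure.real, volume_cylinder_upper hR, volume_cylinder_lower hR hh]

lemma eLpNorm_heightSign (Q : Set E3) :
    eLpNorm heightSign 2 (volume.restrict Q) = volume Q ^ (2⁻¹ : ℝ) := by
  rw [eLpNorm_congr_enorm_ae (g := fun _ => (1 : ℝ)) (.of_forall fun p => by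
    simp [enorm_heightSign]), eLpNorm_const' _ (by norm_num) (by norm_num)]
  simp

lemma memL20NeZero_heightSign (hR : 0 < R) (hh : 0 < h) {Q : Set E3}
    (hQ : Q =ᵐ[volume] cylinder R h) : MemL20NeZero Q heightSign := by
  have hfin := volume_cylinder_ne_top (h := h) hR
  have hpos : 0 < volume (cylinder R h) := by
    rw [volume_cylinder hR]
    exact ENNReal.mul_pos (Metric.measure_ball_pos _ _ hR).ne' (by simpa using hh)
  refine ⟨⟨measurable_heightSign.aestronglyMeasurable, ?_⟩, ?_, fun h0 => ?_⟩
  · rw [eLpNorm_heightSign, measure_congr hQ]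
    exact (ENNReal.rpow_ne_top_of_nonneg (by norm_num) hfin).lt_top
  · rw [setIntegral_congr_set hQ, setIntegral_heightSign hR hh]
  · have hF : ∀ᵐ x ∂(volume.restrict Q), False := by
      filter_upwards [h0] with x hx
      have := enorm_heightSign x
      rw [hx] at this
      simp at this
    rw [Filter.eventually_false_iff_eq_bot, ae_eq_bot, Measure.restrict_eq_zero,
      measure_congr hQ] at hF
    exact hpos.ne' hF

end

namespace SieveFamily

variable {R δ₀ δ₁ : ℝ}

lemma r_pos (P : SieveFamily R δ₀ δ₁) (ε : ℝ) : 0 < P.r ε := Real.exp_pos _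

/-- The placed copy of `closure (K n)` is compact, hence a closed set that contains the aperture. -/
lemma closure_aperture_subset (P : SieveFamily R δ₀ δ₁) {ε : ℝ} (hε : ε ∈ Set.Ioc 0 P.εStar)
    {n : ℕ} (hn : n < P.N ε) :
    closure (P.aperture ε n) ⊆ Metric.ball (P.ξ ε n) (δ₀ * P.r ε) := by
  refine (closure_minimal (Set.image_mono subset_closure) ?_).trans
    (P.aperture_subset ε hε n hn)
  exact ((P.isBounded_K n).isCompact_closure.image (by fun_prop)).isClosed

/-- The disjoint circles separate the centers by `2 δ₁ ε`, and the nesting of concentric balls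
forces `δ₀ r_ε ≤ δ₁ ε`. -/
lemma two_mul_le_norm_sub (P : SieveFamily R δ₀ δ₁) (hδ₁ : 0 < δ₁) {ε : ℝ}
    (hε : ε ∈ Set.Ioc 0 P.εStar) {n m : ℕ} (hn : n < P.N ε) (hm : m < P.N ε) (hnm : n ≠ m) :
    2 * (δ₀ * P.r ε) ≤ ‖P.ξ ε n - P.ξ ε m‖ := by
  have hρ : 0 < δ₁ * ε := mul_pos hδ₁ hε.1
  have h1 := two_mul_le_norm_sub_of_disjoint hρ (P.disjoint_circles ε hε n hn m hm hnm)
  have h2 : δ₀ * P.r ε ≤ δ₁ * ε := by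
    by_contra! hlt
    have : P.ξ ε n + EuclideanSpace.single 0 (δ₁ * ε) ∈ Metric.ball (P.ξ ε n) (δ₁ * ε) :=
      P.ball_subset_ball ε hε n hn (by
        rw [mem_ball_iff_norm, add_sub_cancel_left, PiLp.norm_single, Real.norm_of_nonneg hρ.le]
        exact hlt)
    rw [mem_ball_iff_norm, add_sub_cancel_left, PiLp.norm_single, Real.norm_of_nonneg hρ.le] at this
    exact lt_irrefl _ this
  linarith

/-- The perforated domain meets the plane `z = 0` only in the disks around the apertures. -/
lemma mem_of_slice_zero_mem_domain (P : SieveFamily R δ₀ δ₁) (hR : 0 < R) {h ε : ℝ}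
    (hε : ε ∈ Set.Ioc 0 P.εStar) {x : E2} (hx : slice x 0 ∈ P.domain h ε) :
    x ∈ (⋃ n : Fin (P.N ε), Metric.ball (P.ξ ε n) (δ₀ * P.r ε)) ∩ Metric.ball 0 R := by
  have hxR : x ∈ Metric.ball (0 : E2) R := (mem_ball_zero_iff_sq hR x).2 hx.1.1
  refine ⟨?_, hxR⟩
  by_contra hxU
  refine hx.2 (subset_closure ⟨?_, rfl⟩)
  simp only [slice_zero, slice_one, E2_eta]
  refine ⟨hxR, fun hxK => hxU ?_⟩
  simp only [Set.mem_iUnion, Finset.mem_range] at hxK ⊢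
  obtain ⟨n, hn, hxn⟩ := hxK
  exact ⟨⟨n, hn⟩, P.closure_aperture_subset hε hn hxn⟩

end SieveFamily

end

theorem lemma2p3 (R h δ₀ δ₁ : ℝ) (hR : 0 < R) (hRh : R < h) (hδ₀ : 0 < δ₀) (hδ₁ : 0 < δ₁) :
    ∃ C : ℝ, 0 < C ∧ ∀ (P : SieveFamily R δ₀ δ₁) (ε : ℝ), ε ∈ Set.Ioc 0 P.εStar →
      ENNReal.ofReal (C / Real.sqrt (P.r ε)) ≤ bogovskiiConstant (P.domain h ε) := by
  have hh : 0 < h := hR.trans hRh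
  obtain ⟨A, hA4, hA⟩ := exists_finset_shift
  set β : ℝ := volume.real (Metric.ball (0 : E2) R)
  have hβ : volume (Metric.ball (0 : E2) R) = ENNReal.ofReal β :=
    (ENNReal.ofReal_toReal measure_ball_lt_top.ne).symm
  have hβpos : 0 < β := ENNReal.toReal_pos (Metric.measure_ball_pos _ _ hR).ne'
    measure_ball_lt_top.ne
  -- The flux constant without its factor `√r_ε`; the added `1` keeps it positive without knowing
  -- that `A` is nonempty.
  set k : ℝ := √(β * (A.card * (20 * δ₀))) + 1
  have hk : 0 < k := by positivity
  -- From `β h ≤ k √r_ε ‖∇v‖` and `‖g‖ = √(2 β h)`. The value involves only `R`, `h`, `δ₀` and the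
  -- universal set `A`; `δ₁` enters only through the separation of the disks.
  refine ⟨√(β * (2 * h)) / (2 * k), by positivity, fun P ε hε => ?_⟩
  set Q := P.domain h ε
  have hr := P.r_pos ε
  have hQ : Q =ᵐ[volume] cylinder R h := ae_eq_cylinder R h _
  have hQm : MeasurableSet Q :=
    (isOpen_cylinder R h).measurableSet.diff isClosed_closure.measurableSet
  have hvQ : volume Q = ENNReal.ofReal (β * (2 * h)) := by
    rw [measure_congr hQ, volume_cylinder hR, hβ, ← ENNReal.ofReal_mul hβpos.le]
  have hvQu : volume (Q ∩ {p : E3 | 0 < p 2}) = ENNReal.ofReal (β * h) := by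
    rw [measure_congr (ae_eq_set_inter hQ (ae_eq_refl {p : E3 | 0 < p 2})),
      volume_cylinder_upper hR, hβ,
      ← ENNReal.ofReal_mul hβpos.le]
  refine le_trans ?_ (le_iSup₂ heightSign (memL20NeZero_heightSign hR hh hQ))
  refine le_iInf₂ fun v G => le_iInf₂ fun hvG hdiv => ?_
  have hflux : ‖∫ p in Q ∩ {p : E3 | 0 < p 2}, ∑ i, G p (i, i)‖ₑ ≤
      ENNReal.ofReal (k * √(P.r ε)) * eLpNorm G 2 (volume.restrict Q) := by
    refine hvG.enorm_setIntegral_div_le (by simp [hvQ]) ENNReal.ofReal_ne_top fun φ hφ => ?_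
    refine (enorm_setIntegral_div_le hφ (mul_pos hδ₀ hr) hA4
      (U := ⋃ n : Fin (P.N ε), Metric.ball (P.ξ ε n) (δ₀ * P.r ε)) (fun x hx => ?_)
      (fun x => P.mem_of_slice_zero_mem_domain hR hε)).trans ?_
    · obtain ⟨n, hn⟩ := Set.mem_iUnion.1 hx
      obtain ⟨a, ha, hxa⟩ := hA (fun n : Fin (P.N ε) => P.ξ ε n) _ (mul_pos hδ₀ hr)
        (fun i j hij => P.two_mul_le_norm_sub hδ₁ hε i.2 j.2 (Fin.val_ne_of_ne hij)) n x hn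
      exact ⟨a, ha, by simpa using hxa⟩
    · gcongr
      rw [hβ, ← ENNReal.ofReal_natCast, ← ENNReal.ofReal_mul (by positivity),
        ← ENNReal.ofReal_mul hβpos.le, ENNReal.ofReal_rpow_of_nonneg (by positivity) (by norm_num)]
      apply ENNReal.ofReal_le_ofReal
      rw [← one_div, ← Real.sqrt_eq_rpow,
        show β * (A.card * (20 * (δ₀ * P.r ε))) = β * (A.card * (20 * δ₀)) * P.r ε by ring,
        Real.sqrt_mul (by positivity)]
      gcongr
      simp [k]
  have hint : ∫ p in Q ∩ {p : E3 | 0 < p 2}, ∑ i, G p (i, i) = β * h := by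
    have h1 : ∀ᵐ p ∂(volume.restrict (Q ∩ {p : E3 | 0 < p 2})), ∑ i, G p (i, i) = 1 := by
      filter_upwards [ae_restrict_of_ae_restrict_of_subset Set.inter_subset_left hdiv,
        ae_restrict_mem (hQm.inter measurableSet_upper)] with p hp hpu
      rw [hp]; exact if_pos hpu.2
    rw [integral_congr_ae h1]
    simp [Measure.real, hvQu, ENNReal.toReal_ofReal (mul_pos hβpos hh).le]
  obtain ⟨n, hn⟩ : ∃ n : ℝ, 0 ≤ n ∧ eLpNorm G 2 (volume.restrict Q) = ENNReal.ofReal n :=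
    ⟨_, ENNReal.toReal_nonneg, (ENNReal.ofReal_toReal hvG.memH1.memLp_grad.2.ne).symm⟩
  rw [hint, hn.2, ← ENNReal.ofReal_mul (by positivity), ← ofReal_norm,
    ENNReal.ofReal_le_ofReal_iff (by have := hn.1; positivity),
    Real.norm_of_nonneg (by positivity)] at hflux
  rw [hn.2, eLpNorm_heightSign, hvQ, ENNReal.ofReal_rpow_of_nonneg (by positivity) (by norm_num),
    ← one_div, ← Real.sqrt_eq_rpow, ENNReal.le_div_iff_mul_le (.inl (by
      simp only [ne_eq, ENNReal.ofReal_eq_zero, not_le]; positivity))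
      (.inl ENNReal.ofReal_ne_top), ← ENNReal.ofReal_mul (by positivity)]
  apply ENNReal.ofReal_le_ofReal
  have hsq := Real.mul_self_sqrt (show 0 ≤ β * (2 * h) by positivity)
  have hrs : 0 < √(P.r ε) := Real.sqrt_pos.2 hr
  rw [div_div, div_mul_eq_mul_div, hsq, div_le_iff₀ (by positivity)]
  linarith
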